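/- Let $H$ be a complex Hilbert space and $\rho>0$. A bounded operator $T$ on $H$ is a $\rho$-contraction if there are a Hilbert space $\mathcal H$ containing $H$ as a closed subspace and a unitary operator $U$ on $\mathcal H$ with $T^k=\rho P_HU^k|_H$ for all integers $k\ge 1$, where $P_H$ is the orthogonal projection onto $H$. The $\rho$-numerical radius of $T$ is $w_\rho(T)=\inf\{\gamma>0:\gamma^{-1}T\text{ is a }\rho\text{-contraction}\}$. Let $S_{n+1}$ be the truncated shift on $\mathbb C^{n+1}$ with its Euclidean norm, i.e. the $(n+1)\times(n+1)$ matrix with ones on the superdiagonal and zeros elsewhere. **Proposition.** Let $n\ge 1$. For $\rho>1$ put $a=a(\rho)=w_\rho(S_{n+1})^{-1}$ and let $$\Delta(\rho)=\alpha^2-4\beta=(a^2-1)\,((a+1)\rho-2a)\,((a-1)\rho-2a)$$ be the discriminant of $r^2-\alpha r+\beta$, where $\alpha=\rho+(\rho-2)a^2$ and $\beta=a^2(1-\rho)^2$. Then the critical value $\rho_0$, i.e. the unique $\rho>1$ with $\Delta(\rho)=0$, is $\rho_0=n+2$; and $$w_{n+2}(S_{n+1})=\frac{n}{n+2}.$$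 Consequently, for every bounded operator $T$ on a complex Hilbert space and every integer $m\ge 2$ with $T^m=0$, $$w_{m+1}(T)\le\frac{m-1}{m+1}\,\|T\|.$$ -/

import Mathlib

universe u

/-- `T` is a `ρ`-contraction on the Hilbert space `H`: it has a unitary `ρ`-dilation, that is, there
are a Hilbert space `K`, an isometric embedding `V` of `H` into `K` and a unitary `U` on `K` with
`T ^ k = ρ P_H U ^ k |_H` for all `k ≥ 1`. With `H` identified with its image under `V`, the
compression `P_H A |_H` of an operator `A` on `K` is `V† A V`. (A minimal dilation space has
dimension at most `ℵ₀ * dim H`, so taking `K` in the universe of `H` is no restriction.) -/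
def IsRhoContraction {H : Type u} [NormedAddCommGroup H] [InnerProductSpace ℂ H] [CompleteSpace H]
    (ρ : ℝ) (T : H →L[ℂ] H) : Prop :=
  ∃ (K : Type u) (_ : NormedAddCommGroup K) (_ : InnerProductSpace ℂ K) (_ : CompleteSpace K)
    (V : H →ₗᵢ[ℂ] K) (U : K →L[ℂ] K), U ∈ unitary (K →L[ℂ] K) ∧
      ∀ k : ℕ, 1 ≤ k → T ^ k =
        (ρ : ℂ) • (ContinuousLinearMap.adjoint V.toContinuousLinearMap ∘L
          (U ^ k) ∘L V.toContinuousLinearMap)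

/-- The `ρ`-numerical radius (operator radius) `w_ρ(T) = inf {γ > 0 : γ⁻¹ T is a ρ-contraction}`. -/
noncomputable def rhoRadius {H : Type u} [NormedAddCommGroup H] [InnerProductSpace ℂ H]
    [CompleteSpace H] (ρ : ℝ) (T : H →L[ℂ] H) : ℝ :=
  sInf {γ : ℝ | 0 < γ ∧ IsRhoContraction ρ (((γ⁻¹ : ℝ) : ℂ) • T)}

/-- The truncated shift `S_N` on `ℂ ^ N` (Euclidean norm): the `N × N` matrix with ones on the
superdiagonal and zeros elsewhere. -/
noncomputable def truncatedShift (N : ℕ) :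
    EuclideanSpace ℂ (Fin N) →L[ℂ] EuclideanSpace ℂ (Fin N) :=
  Matrix.toEuclideanCLM (𝕜 := ℂ)
    (Matrix.of fun i j : Fin N => if (i : ℕ) + 1 = (j : ℕ) then (1 : ℂ) else 0)

/-- `a(ρ) = w_ρ(S_{n+1})⁻¹`. -/
noncomputable def shiftScale (n : ℕ) (ρ : ℝ) : ℝ :=
  (rhoRadius ρ (truncatedShift (n + 1)))⁻¹

/-- The discriminant `Δ` of `r² - α r + β`, where `α = ρ + (ρ - 2) a²`, `β = a² (1 - ρ)²` and
`a = a(ρ) = w_ρ(S_{n+1})⁻¹`. -/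
noncomputable def shiftDiscriminant (n : ℕ) (ρ : ℝ) : ℝ :=
  discrim (1 : ℝ) (-(ρ + (ρ - 2) * shiftScale n ρ ^ 2)) (shiftScale n ρ ^ 2 * (1 - ρ) ^ 2)

theorem shiftDiscriminant_eq (n : ℕ) (ρ : ℝ) :
    shiftDiscriminant n ρ = (shiftScale n ρ ^ 2 - 1) *
      ((shiftScale n ρ + 1) * ρ - 2 * shiftScale n ρ) *
      ((shiftScale n ρ - 1) * ρ - 2 * shiftScale n ρ) := by
  unfold shiftDiscriminant discrim
  ring

/-! Everything reduces to positivity of the Toeplitz matrix M(ρ,a) with diagonal 1 and entries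
a^|i-j|/ρ. If a·S_N has a unitary ρ-dilation U, then M is the Gram matrix of the vectors U^i e_i.
Conversely, a factorization M = BᵀB yields an explicit dilation of a·T on ℓ²(ℤ; H^N) for every
contraction T with T^N = 0 (`isRhoContraction_of_posSemidef`). The estimate for the shift therefore
passes to all nilpotent operators.

For ρ > 1, a(ρ) is the largest a with M(ρ,a) ≥ 0: positivity is inherited by smaller a ≥ 0 through
Schur multiplication by r^|i-j|, and is closed in a. Since definiteness is open, M is singular at
a(ρ). For a null vector x, the convolution K of x with a^|·| is proportional to x and satisfies a
three-term recurrence with boundary conditions K_0 = aK_1, K_{n+2} = aK_{n+1}. As 1 < a ≤ ρ, only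
the last factor of Δ can vanish. Then the recurrence has the double root 1, K is affine, and the
boundary conditions force ρ = n+2 (`eq_add_two_of_null`).

Conversely, at ρ = n+2, a = (n+2)/n the form is nonnegative by summation by parts and
Cauchy–Schwarz, and vanishes on the vector n-2i. Strictness in the Schur argument then excludes any
larger a (`shiftScale_critical`). -/

open Finset ContinuousLinearMap Filter Topology
open scoped InnerProductSpace

/-! ### The Toeplitz quadratic form -/

/-- The entries of the Toeplitz matrix with diagonal `1` and off-diagonal entries `a ^ |i - j| / ρ`. -/
noncomputable def toeplitzEntry (ρ a : ℝ) (i j : ℕ) : ℝ :=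
  if i = j then 1 else a ^ Nat.dist i j / ρ

/-- The `N × N` Toeplitz matrix with diagonal `1` and off-diagonal entries `a ^ |i - j| / ρ`. -/
noncomputable def toeplitzMatrix (ρ a : ℝ) (N : ℕ) : Matrix (Fin N) (Fin N) ℝ :=
  Matrix.of fun i j => toeplitzEntry ρ a i j

/-- The quadratic form of `toeplitzMatrix`, on sequences. -/
noncomputable def toeplitzForm (ρ a : ℝ) (N : ℕ) (x : ℕ → ℝ) : ℝ :=
  ∑ i ∈ range N, ∑ j ∈ range N, x i * toeplitzEntry ρ a i j * x j

theorem toeplitzEntry_comm (ρ a : ℝ) (i j : ℕ) : toeplitzEntry ρ a i j = toeplitzEntry ρ a j i := by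
  simp only [toeplitzEntry, Nat.dist_comm i j, eq_comm]

theorem toeplitzMatrix_isHermitian (ρ a : ℝ) (N : ℕ) : (toeplitzMatrix ρ a N).IsHermitian := by
  ext i j
  simp [toeplitzMatrix, toeplitzEntry_comm]

theorem dotProduct_toeplitzMatrix_mulVec (ρ a : ℝ) (N : ℕ) (x : ℕ → ℝ) :
    (fun i : Fin N => x i) ⬝ᵥ (toeplitzMatrix ρ a N).mulVec (fun i : Fin N => x i) =
      toeplitzForm ρ a N x := by
  simp only [dotProduct, Matrix.mulVec, toeplitzForm, toeplitzMatrix, Matrix.of_apply]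
  rw [Finset.sum_range]
  refine Finset.sum_congr rfl fun i _ => ?_
  rw [Finset.sum_range, Finset.mul_sum]
  exact Finset.sum_congr rfl fun j _ => by ring

/-- Extension by zero of a finite vector to a sequence. -/
def extendZero {N : ℕ} (x : Fin N → ℝ) (i : ℕ) : ℝ := if h : i < N then x ⟨i, h⟩ else 0

theorem extendZero_comp {N : ℕ} (x : Fin N → ℝ) : (fun i : Fin N => extendZero x i) = x := by
  ext i
  simp [extendZero]

theorem toeplitzMatrix_posSemidef_iff {ρ a : ℝ} {N : ℕ} :
    (toeplitzMatrix ρ a N).PosSemidef ↔ ∀ x, 0 ≤ toeplitzForm ρ a N x := by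
  rw [Matrix.posSemidef_iff_dotProduct_mulVec]
  refine ⟨fun h x => ?_, fun h => ⟨toeplitzMatrix_isHermitian ρ a N, fun x => ?_⟩⟩
  · rw [← dotProduct_toeplitzMatrix_mulVec]
    exact h.2 _
  · have := h (extendZero x)
    rwa [← dotProduct_toeplitzMatrix_mulVec, extendZero_comp] at this

/-! ### Schur multiplication and monotonicity in a -/

/-- Telescoping in k. The result writes the matrix r^|i-j| as one rank-one square plus 1-r² times a
sum of n others, so it is positive when r² ≤ 1. -/
theorem pow_dist_eq (r : ℝ) {n i j : ℕ} (hi : i ≤ n) (hj : j ≤ n) :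
    r ^ Nat.dist i j = r ^ i * r ^ j + (1 - r ^ 2) *
      ∑ k ∈ range n, (if k < i then r ^ (i - (k + 1)) else 0) *
        (if k < j then r ^ (j - (k + 1)) else 0) := by
  have key := Finset.sum_range_sub (fun k => r ^ (Nat.dist i j + 2 * (min i j - k))) n
  have h0 : Nat.dist i j + 2 * (min i j - 0) = i + j := by unfold Nat.dist; omega
  have hn : Nat.dist i j + 2 * (min i j - n) = Nat.dist i j := by unfold Nat.dist; omega
  rw [h0, hn] at key
  rw [Finset.mul_sum, ← pow_add, ← sub_eq_iff_eq_add', ← key]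
  refine Finset.sum_congr rfl fun k _ => ?_
  by_cases h : k < i ∧ k < j
  · rw [if_pos h.1, if_pos h.2, ← pow_add]
    have h1 : Nat.dist i j + 2 * (min i j - (k + 1)) = i - (k + 1) + (j - (k + 1)) := by
      unfold Nat.dist; omega
    have h2 : Nat.dist i j + 2 * (min i j - k) = i - (k + 1) + (j - (k + 1)) + 2 := by
      unfold Nat.dist; omega
    rw [h1, h2]
    ring
  · have h1 : min i j - (k + 1) = min i j - k := by omega
    rw [h1]
    rcases not_and_or.1 h with h | h <;> simp [h]

theorem toeplitzEntry_mul (ρ a r : ℝ) (i j : ℕ) :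
    toeplitzEntry ρ (a * r) i j = toeplitzEntry ρ a i j * r ^ Nat.dist i j := by
  unfold toeplitzEntry
  split_ifs with h
  · simp [h, Nat.dist_self]
  · rw [mul_pow]; ring

theorem toeplitzForm_mul (ρ a r : ℝ) (n : ℕ) (x : ℕ → ℝ) :
    toeplitzForm ρ (a * r) (n + 1) x = toeplitzForm ρ a (n + 1) (fun i => r ^ i * x i) +
      (1 - r ^ 2) * ∑ k ∈ range n, toeplitzForm ρ a (n + 1)
        (fun i => (if k < i then r ^ (i - (k + 1)) else 0) * x i) := by
  unfold toeplitzForm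
  rw [Finset.sum_comm (s := range n), Finset.mul_sum, ← Finset.sum_add_distrib]
  refine Finset.sum_congr rfl fun i hi => ?_
  rw [Finset.sum_comm (s := range n), Finset.mul_sum, ← Finset.sum_add_distrib]
  refine Finset.sum_congr rfl fun j hj => ?_
  rw [toeplitzEntry_mul, pow_dist_eq r (Nat.lt_succ_iff.1 (mem_range.1 hi))
    (Nat.lt_succ_iff.1 (mem_range.1 hj)), mul_add, mul_add, add_mul, Finset.mul_sum, Finset.mul_sum,
    Finset.mul_sum, Finset.mul_sum, Finset.sum_mul]
  congr 1
  · ring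
  · exact Finset.sum_congr rfl fun k _ => by ring

theorem toeplitzForm_single (ρ a : ℝ) (n : ℕ) (x : ℕ → ℝ) (h : ∀ i < n, x i = 0) :
    toeplitzForm ρ a (n + 1) x = x n ^ 2 := by
  unfold toeplitzForm
  rw [Finset.sum_range_succ, Finset.sum_eq_zero, Finset.sum_range_succ, Finset.sum_eq_zero]
  · simp [toeplitzEntry]; ring
  · intro i hi; simp [h i (mem_range.1 hi)]
  · intro i hi; simp [h i (mem_range.1 hi)]

/-- All summands of `toeplitzForm_mul` are nonnegative, and the one with k = n-1 sees only the last
coordinate. Keeping it makes the monotonicity strict on vectors with x_n ≠ 0. -/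
theorem le_toeplitzForm_mul {ρ a r : ℝ} {n : ℕ} (hn : 1 ≤ n) (h : ∀ x, 0 ≤ toeplitzForm ρ a (n + 1) x)
    (hr : r ^ 2 ≤ 1) (x : ℕ → ℝ) :
    (1 - r ^ 2) * x n ^ 2 ≤ toeplitzForm ρ (a * r) (n + 1) x := by
  obtain ⟨m, rfl⟩ : ∃ m, n = m + 1 := ⟨n - 1, by omega⟩
  rw [toeplitzForm_mul, Finset.sum_range_succ, toeplitzForm_single ρ a (m + 1)
    (fun i => (if m < i then r ^ (i - (m + 1)) else 0) * x i)]
  · have h1 := Finset.sum_nonneg fun k (_ : k ∈ range m) => h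
      (fun i => (if k < i then r ^ (i - (k + 1)) else 0) * x i)
    have h2 := h (fun i => r ^ i * x i)
    have h3 : 0 ≤ 1 - r ^ 2 := by linarith
    have h4 := mul_nonneg h3 h1
    simp only [mul_add, lt_add_iff_pos_right, zero_lt_one, if_true, Nat.sub_self, pow_zero,
      one_mul]
    linarith
  · intro i hi
    simp [show ¬ m < i by omega]

theorem toeplitzForm_nonneg_of_le {ρ a b : ℝ} {n : ℕ} (hn : 1 ≤ n) (hb : 0 ≤ b) (hab : b ≤ a)
    (h : ∀ x, 0 ≤ toeplitzForm ρ a (n + 1) x) (x : ℕ → ℝ) : 0 ≤ toeplitzForm ρ b (n + 1) x := by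
  -- For b = 0 take r = 0, since a may vanish and b/a would be meaningless.
  rcases hb.eq_or_lt with rfl | hb
  · have := le_toeplitzForm_mul (r := 0) hn h (by norm_num) x
    rw [mul_zero] at this
    nlinarith [sq_nonneg (x n)]
  · have ha : 0 < a := hb.trans_le hab
    have h1 : (b / a) ^ 2 ≤ 1 := pow_le_one₀ (by positivity) ((div_le_one ha).2 hab)
    have := le_toeplitzForm_mul (r := b / a) hn h h1 x
    rw [mul_div_cancel₀ _ ha.ne'] at this
    exact (mul_nonneg (by linarith) (sq_nonneg _)).trans this

/-! ### Three-term recurrence for the geometric convolution -/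

/-- The convolution of `x` (restricted to `range N`) with `a ^ |·|`, with the index shifted by `1`. -/
noncomputable def geomConv (a : ℝ) (N : ℕ) (x : ℕ → ℝ) (j : ℕ) : ℝ :=
  ∑ i ∈ range N, a ^ Nat.dist (i + 1) j * x i

/-- The kernel a^|·| is, up to the factor 1-a², a Green function of a second-order difference
operator. The index shift leaves room for the left boundary value at 0. -/
theorem pow_dist_three_term (a : ℝ) (i j : ℕ) :
    (1 + a ^ 2) * a ^ Nat.dist (i + 1) (j + 1) - a * a ^ Nat.dist (i + 1) j -
      a * a ^ Nat.dist (i + 1) (j + 2) = if i = j then 1 - a ^ 2 else 0 := by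
  rcases lt_trichotomy i j with h | rfl | h
  · obtain ⟨k, rfl⟩ : ∃ k, j = i + 1 + k := ⟨j - (i + 1), by omega⟩
    have h1 : Nat.dist (i + 1) (i + 1 + k + 1) = k + 1 := by unfold Nat.dist; omega
    have h2 : Nat.dist (i + 1) (i + 1 + k) = k := by unfold Nat.dist; omega
    have h3 : Nat.dist (i + 1) (i + 1 + k + 2) = k + 2 := by unfold Nat.dist; omega
    rw [h1, h2, h3, if_neg (by omega)]
    ring
  · have h1 : Nat.dist (i + 1) (i + 1) = 0 := by unfold Nat.dist; omega
    have h2 : Nat.dist (i + 1) i = 1 := by unfold Nat.dist; omega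
    have h3 : Nat.dist (i + 1) (i + 2) = 1 := by unfold Nat.dist; omega
    rw [h1, h2, h3, if_pos rfl]
    ring
  · obtain ⟨k, rfl⟩ : ∃ k, i = j + 1 + k := ⟨i - (j + 1), by omega⟩
    have h1 : Nat.dist (j + 1 + k + 1) (j + 1) = k + 1 := by unfold Nat.dist; omega
    have h2 : Nat.dist (j + 1 + k + 1) j = k + 2 := by unfold Nat.dist; omega
    have h3 : Nat.dist (j + 1 + k + 1) (j + 2) = k := by unfold Nat.dist; omega
    rw [h1, h2, h3, if_neg (by omega)]
    ring

theorem geomConv_three_term (a : ℝ) {N : ℕ} (x : ℕ → ℝ) {j : ℕ} (hj : j < N) :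
    (1 + a ^ 2) * geomConv a N x (j + 1) - a * geomConv a N x j - a * geomConv a N x (j + 2) =
      (1 - a ^ 2) * x j := by
  unfold geomConv
  rw [mul_sum, mul_sum, mul_sum, ← sum_sub_distrib, ← sum_sub_distrib]
  have : ∀ i ∈ range N, (1 + a ^ 2) * (a ^ Nat.dist (i + 1) (j + 1) * x i) -
      a * (a ^ Nat.dist (i + 1) j * x i) - a * (a ^ Nat.dist (i + 1) (j + 2) * x i) =
      if i = j then (1 - a ^ 2) * x i else 0 := by
    intro i _
    have := congrArg (· * x i) (pow_dist_three_term a i j)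
    simp only [ite_mul, zero_mul] at this
    rw [← this]
    ring
  rw [sum_congr rfl this, sum_ite_eq', if_pos (mem_range.2 hj)]

theorem geomConv_zero (a : ℝ) (N : ℕ) (x : ℕ → ℝ) :
    geomConv a N x 0 = a * geomConv a N x 1 := by
  unfold geomConv
  rw [mul_sum]
  refine sum_congr rfl fun i _ => ?_
  have h1 : Nat.dist (i + 1) 0 = i + 1 := by unfold Nat.dist; omega
  have h2 : Nat.dist (i + 1) 1 = i := by unfold Nat.dist; omega
  rw [h1, h2]
  ring

theorem geomConv_last (a : ℝ) (n : ℕ) (x : ℕ → ℝ) :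
    geomConv a (n + 1) x (n + 2) = a * geomConv a (n + 1) x (n + 1) := by
  unfold geomConv
  rw [mul_sum]
  refine sum_congr rfl fun i hi => ?_
  have hi := mem_range.1 hi
  have h1 : Nat.dist (i + 1) (n + 2) = Nat.dist (i + 1) (n + 1) + 1 := by unfold Nat.dist; omega
  rw [h1]
  ring

theorem sum_toeplitzEntry_mul {ρ : ℝ} (hρ : ρ ≠ 0) (a : ℝ) {N : ℕ} (x : ℕ → ℝ) {i : ℕ} (hi : i < N) :
    ρ * ∑ j ∈ range N, toeplitzEntry ρ a i j * x j = geomConv a N x (i + 1) + (ρ - 1) * x i := by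
  have : (ρ - 1) * x i = ∑ j ∈ range N, if j = i then (ρ - 1) * x j else 0 := by
    rw [sum_ite_eq', if_pos (mem_range.2 hi)]
  rw [this, geomConv, ← sum_add_distrib, mul_sum]
  refine sum_congr rfl fun j _ => ?_
  have h1 : Nat.dist (j + 1) (i + 1) = Nat.dist i j := by unfold Nat.dist; omega
  rw [h1, toeplitzEntry]
  rcases eq_or_ne i j with rfl | h
  · simp [Nat.dist_self]; ring
  · rw [if_neg h, if_neg h.symm]
    field_simp
    ring

theorem mul_toeplitzForm {ρ : ℝ} (hρ : ρ ≠ 0) (a : ℝ) (N : ℕ) (x : ℕ → ℝ) :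
    ρ * toeplitzForm ρ a N x =
      ∑ i ∈ range N, x i * (geomConv a N x (i + 1) + (ρ - 1) * x i) := by
  rw [toeplitzForm, mul_sum]
  refine sum_congr rfl fun i hi => ?_
  rw [← sum_toeplitzEntry_mul hρ a x (mem_range.1 hi), mul_sum, mul_sum, mul_sum]
  exact sum_congr rfl fun j _ => by ring

/-! ### Nonnegativity at the critical parameters -/

theorem sum_second_difference_mul (y : ℕ → ℝ) (n : ℕ) :
    ∑ j ∈ range (n + 1), (2 * y (j + 1) - y j - y (j + 2)) * y (j + 1) =
      ∑ j ∈ range n, (y (j + 1) - y (j + 2)) ^ 2 + (y 1 - y 0) * y 1 +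
        (y (n + 1) - y (n + 2)) * y (n + 1) := by
  induction n with
  | zero => simp; ring
  | succ n ih => rw [sum_range_succ, ih, sum_range_succ]; ring

/-- After summation by parts, Cauchy–Schwarz bounds both the second and the first differences
through their telescoping sums, which depend only on p = y_1 and q = y_{n+1}. What remains is a
nonnegative multiple of (p+q)². -/
theorem second_difference_energy_nonneg {n : ℕ} (hn : 1 ≤ n) {a : ℝ} (ha : a = (n + 2) / n)
    {y : ℕ → ℝ} (h0 : y 0 = a * y 1) (h1 : y (n + 2) = a * y (n + 1)) :
    0 ≤ a * ∑ j ∈ range (n + 1), (2 * y (j + 1) - y j - y (j + 2)) ^ 2 +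
      4 / n ^ 2 * ∑ j ∈ range (n + 1), (2 * y (j + 1) - y j - y (j + 2)) * y (j + 1) := by
  have hn0 : (0 : ℝ) < n := by exact_mod_cast hn
  rw [sum_second_difference_mul]
  have hw := sq_sum_le_card_mul_sum_sq (s := range (n + 1))
    (f := fun j => 2 * y (j + 1) - y j - y (j + 2))
  have hd := sq_sum_le_card_mul_sum_sq (s := range n) (f := fun j => y (j + 1) - y (j + 2))
  have sw : ∑ j ∈ range (n + 1), (2 * y (j + 1) - y j - y (j + 2)) =
      (y 1 - y 0) - (y (n + 2) - y (n + 1)) := by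
    rw [← sum_range_sub' (fun j => y (j + 1) - y j)]
    exact sum_congr rfl fun j _ => by ring
  have sd : ∑ j ∈ range n, (y (j + 1) - y (j + 2)) = y 1 - y (n + 1) :=
    sum_range_sub' (fun j => y (j + 1)) n
  rw [sw, card_range] at hw
  rw [sd, card_range] at hd
  set W := ∑ j ∈ range (n + 1), (2 * y (j + 1) - y j - y (j + 2)) ^ 2
  set D := ∑ j ∈ range n, (y (j + 1) - y (j + 2)) ^ 2
  rw [h0, h1] at hw ⊢
  set p := y 1
  set q := y (n + 1)
  have ha1 : a - 1 = 2 / n := by rw [ha]; field_simp; ring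
  have e1 : (p - a * p - (a * q - q)) ^ 2 = 4 / n ^ 2 * (p + q) ^ 2 := by
    have : p - a * p - (a * q - q) = -((a - 1) * (p + q)) := by ring
    rw [this, ha1]; field_simp; ring
  have e2 : (p - a * p) * p + (q - a * q) * q = -(2 / n * (p ^ 2 + q ^ 2)) := by
    rw [← ha1]; ring
  rw [e1] at hw
  push_cast at hw
  have hD : (p - q) ^ 2 / n ≤ D := by rw [div_le_iff₀ hn0]; linarith
  have hW : 4 / (n : ℝ) ^ 2 * (p + q) ^ 2 / (n + 1) ≤ W := by
    rw [div_le_iff₀ (by positivity)]; linarith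
  have hE : -((p + q) ^ 2 / n) ≤ D + (p - a * p) * p + (q - a * q) * q := by
    rw [add_assoc, e2]
    have : -((p + q) ^ 2 / n) = (p - q) ^ 2 / n + -(2 / n * (p ^ 2 + q ^ 2)) := by
      field_simp; ring
    linarith
  have ha0 : 0 < a := by rw [ha]; positivity
  have hc : 0 < 4 / (n : ℝ) ^ 2 := by positivity
  have t1 := mul_le_mul_of_nonneg_left hW ha0.le
  have t2 := mul_le_mul_of_nonneg_left hE hc.le
  have t3 : 0 ≤ a * (4 / (n : ℝ) ^ 2 * (p + q) ^ 2 / (n + 1)) + 4 / (n : ℝ) ^ 2 * -((p + q) ^ 2 / n) := by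
    have : a * (4 / (n : ℝ) ^ 2 * (p + q) ^ 2 / (n + 1)) + 4 / (n : ℝ) ^ 2 * -((p + q) ^ 2 / n) =
        4 * (p + q) ^ 2 / (n ^ 3 * (n + 1)) := by
      rw [ha]; field_simp; ring
    rw [this]; positivity
  linarith

theorem toeplitzForm_critical_nonneg {n : ℕ} (hn : 1 ≤ n) (x : ℕ → ℝ) :
    0 ≤ toeplitzForm (n + 2) ((n + 2) / n) (n + 1) x := by
  have hn0 : (0 : ℝ) < n := by exact_mod_cast hn
  set a : ℝ := (n + 2) / n with ha
  -- With this normalization x_j is the difference operator applied to y, and K_{j+1} + (ρ-1)x_j =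
  -- (n+1)·a·w_j, where w is the negated second difference of y.
  set y : ℕ → ℝ := fun j => geomConv a (n + 1) x j / (1 - a ^ 2) with hy
  have ha2 : 1 - a ^ 2 = -(4 * (n + 1) / n ^ 2) := by rw [ha]; field_simp; ring
  have hne : 1 - a ^ 2 ≠ 0 := by rw [ha2]; exact neg_ne_zero.2 (by positivity)
  have hK : ∀ j, geomConv a (n + 1) x j = (1 - a ^ 2) * y j := fun j => by
    simp only [hy]; field_simp
  have hx : ∀ j ∈ range (n + 1), x j = a * (2 * y (j + 1) - y j - y (j + 2)) +
      4 / n ^ 2 * y (j + 1) := by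
    intro j hj
    have := geomConv_three_term a x (mem_range.1 hj)
    simp only [hK] at this
    have h2 : x j = (1 + a ^ 2) * y (j + 1) - a * y j - a * y (j + 2) := by
      apply mul_left_cancel₀ hne
      rw [← this]; ring
    have h3 : 1 + a ^ 2 = 2 * a + 4 / n ^ 2 := by rw [ha]; field_simp; ring
    rw [h2, h3]; ring
  have hE := second_difference_energy_nonneg hn ha (y := y)
    (by simp only [hy, geomConv_zero]; ring) (by simp only [hy, geomConv_last]; ring)
  have hρ : (n : ℝ) + 2 ≠ 0 := by positivity
  have key : ((n : ℝ) + 2) * toeplitzForm (n + 2) a (n + 1) x = (n + 1) * a *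
      (a * ∑ j ∈ range (n + 1), (2 * y (j + 1) - y j - y (j + 2)) ^ 2 +
      4 / n ^ 2 * ∑ j ∈ range (n + 1), (2 * y (j + 1) - y j - y (j + 2)) * y (j + 1)) := by
    rw [mul_toeplitzForm hρ, mul_sum, mul_sum, ← sum_add_distrib, mul_sum]
    refine sum_congr rfl fun j hj => ?_
    rw [hK, hx j hj, ha2]
    field_simp
    ring
  refine nonneg_of_mul_nonneg_right (a := (n : ℝ) + 2) ?_ (by positivity)
  rw [key]
  exact mul_nonneg (by positivity) hE

/-! ### The null vector n-2i at the critical parameters -/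

theorem sum_geom_mul_lower {a c : ℝ} (h : a * c = c + 2) (j : ℕ) :
    ∑ i ∈ range (j + 1), a ^ (j - i) * (c - 2 * i) = c * (j + 1) := by
  induction j with
  | zero => simp
  | succ j ih =>
    rw [sum_range_succ]
    have : ∑ i ∈ range (j + 1), a ^ (j + 1 - i) * (c - 2 * i) =
        a * ∑ i ∈ range (j + 1), a ^ (j - i) * (c - 2 * i) := by
      rw [mul_sum]
      refine sum_congr rfl fun i hi => ?_
      rw [Nat.succ_sub (Nat.lt_succ_iff.1 (mem_range.1 hi)), pow_succ]; ring
    rw [this, ih]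
    simp only [Nat.sub_self, pow_zero]
    push_cast
    linear_combination ((j : ℝ) + 1) * h

theorem sum_geom_mul_upper {a c : ℝ} (h : a * c = c + 2) (j m : ℕ) :
    ∑ i ∈ range m, a ^ i * (c - 2 * (j + i)) =
      a ^ m * (c * (c - j + 1 - m)) - c * (c - j + 1) := by
  induction m with
  | zero => simp
  | succ m ih =>
    rw [sum_range_succ, ih]
    push_cast
    linear_combination -(a ^ m * (c - j - m)) * h

theorem toeplitzForm_critical_null {n : ℕ} (hn : 1 ≤ n) :
    toeplitzForm (n + 2) ((n + 2) / n) (n + 1) (fun i => n - 2 * i) = 0 := by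
  have hn0 : (0 : ℝ) < n := by exact_mod_cast hn
  set a : ℝ := (n + 2) / n with ha
  have hac : a * n = n + 2 := by rw [ha]; field_simp
  have hρ : (n : ℝ) + 2 ≠ 0 := by positivity
  refine (mul_eq_zero.1 ?_).resolve_left hρ
  rw [mul_toeplitzForm hρ]
  refine sum_eq_zero fun j hj => ?_
  have hj := mem_range.1 hj
  -- The sums over i ≤ j and i ≥ j both contain the diagonal term, hence the added n-2j. The
  -- coefficient of a^(n+1-j) turns out to be zero.
  have hs : geomConv a (n + 1) (fun i => (n : ℝ) - 2 * i) (j + 1) + (n - 2 * j) =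
      n * (j + 1) + (a ^ (n + 1 - j) * (n * (n - j + 1 - (n + 1 - j : ℕ))) - n * (n - j + 1)) := by
    rw [← sum_geom_mul_lower hac, ← sum_geom_mul_upper hac, sum_range_succ]
    have h1 : n + 1 - j = (n - j) + 1 := by omega
    have h2 : geomConv a (n + 1) (fun i => (n : ℝ) - 2 * i) (j + 1) =
        ∑ i ∈ range j, a ^ (j - i) * ((n : ℝ) - 2 * i) +
          ∑ i ∈ range (n + 1 - j), a ^ i * ((n : ℝ) - 2 * (j + i)) := by
      have h3 : n + 1 = j + (n + 1 - j) := by omega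
      unfold geomConv
      conv_lhs => rw [h3]
      rw [sum_range_add]
      congr 1
      · refine sum_congr rfl fun i hi => ?_
        have hi := mem_range.1 hi
        have h4 : Nat.dist (i + 1) (j + 1) = j - i := by unfold Nat.dist; omega
        rw [h4]
      · refine sum_congr rfl fun i hi => ?_
        have h4 : Nat.dist (j + i + 1) (j + 1) = i := by unfold Nat.dist; omega
        rw [h4]; push_cast; ring
    rw [h2]
    simp
    ring
  have h5 : ((n + 1 - j : ℕ) : ℝ) = n + 1 - j := by
    rw [Nat.cast_sub (by omega)]; push_cast; ring
  rw [h5] at hs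
  have h6 : geomConv a (n + 1) (fun i => (n : ℝ) - 2 * i) (j + 1) = -((n + 1) * (n - 2 * j)) := by
    linear_combination hs
  rw [h6]
  ring

/-! ### The double root forces ρ = n+2 -/

theorem eq_add_two_of_null {n : ℕ} {ρ a : ℝ} (hρ : 2 < ρ) (ha : (a - 1) * ρ = 2 * a)
    {x : ℕ → ℝ} (hx : ∀ i < n + 1, geomConv a (n + 1) x (i + 1) + (ρ - 1) * x i = 0)
    (hne : ∃ i < n + 1, x i ≠ 0) : ρ = n + 2 := by
  have ha' : a = ρ / (ρ - 2) := by
    rw [eq_div_iff (by linarith)]; linarith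
  set k := geomConv a (n + 1) x with hk
  have hrec : ∀ j < n + 1, k (j + 2) = 2 * k (j + 1) - k j := by
    intro j hj
    have h1 := geomConv_three_term a x hj
    rw [← hk] at h1
    have h2 : x j = -k (j + 1) / (ρ - 1) := by
      rw [eq_div_iff (by linarith)]; linarith [hx j hj]
    have h3 : (1 - a ^ 2) * x j = (a ^ 2 - 1) / (ρ - 1) * k (j + 1) := by rw [h2]; ring
    have hr2 : ρ - 2 ≠ 0 := by linarith
    have hr1 : ρ - 1 ≠ 0 := by linarith
    -- This is where the vanishing factor of Δ enters: it turns the recurrence into a vanishing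
    -- second difference.
    have h4 : (a ^ 2 - 1) / (ρ - 1) = 1 + a ^ 2 - 2 * a := by
      rw [ha']; field_simp; ring
    have ha0 : a ≠ 0 := by rw [ha']; exact div_ne_zero (by linarith) hr2
    rw [h3, h4] at h1
    apply mul_left_cancel₀ ha0
    linarith
  have haff : ∀ j ≤ n + 1, k j = k 1 * (a - (a - 1) * j) ∧
      k (j + 1) = k 1 * (a - (a - 1) * (j + 1)) := by
    intro j
    induction j with
    | zero => intro _; constructor
              · rw [hk, geomConv_zero]; push_cast; ring
              · simp
    | succ j ih =>
      intro hj
      obtain ⟨h1, h2⟩ := ih (by omega)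
      refine ⟨by rw [h2]; push_cast; ring, ?_⟩
      rw [hrec j (by omega), h1, h2]; push_cast; ring
  have hk1 : k 1 ≠ 0 := by
    intro h
    obtain ⟨i, hi, hxi⟩ := hne
    have h1 := hx i hi
    rw [(haff i (by omega)).2, h, zero_mul, zero_add] at h1
    rcases mul_eq_zero.1 h1 with h2 | h2
    · linarith
    · exact hxi h2
  have hl := geomConv_last a n x
  rw [← hk, (haff (n + 1) le_rfl).2, (haff (n + 1) le_rfl).1] at hl
  -- The right boundary condition for an affine K, which factors as (a-1)(an-(n+2)) = 0.
  have h1 : a - (a - 1) * ((n + 1 : ℕ) + 1) = a * (a - (a - 1) * (n + 1 : ℕ)) := by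
    apply mul_left_cancel₀ hk1; linarith
  push_cast at h1
  have h2 : (a - 1) * (a * n - (n + 2)) = 0 := by linear_combination h1
  have ha1 : a - 1 = 2 / (ρ - 2) := by
    have hr2 : ρ - 2 ≠ 0 := by linarith
    rw [ha']; field_simp; ring
  have ha1' : 0 < a - 1 := by rw [ha1]; exact div_pos two_pos (by linarith)
  have h3 := (mul_eq_zero.1 h2).resolve_left ha1'.ne'
  have h4 : (a - 1) * (ρ - (n + 2)) = 0 := by linear_combination ha - h3
  linarith [(mul_eq_zero.1 h4).resolve_left ha1'.ne']

/-! ### Unitary dilation of nilpotent contractions -/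

section Reindex

variable {ι : Type*} {G : Type*} [NormedAddCommGroup G]

theorem memℓp_comp_equiv (e : ι ≃ ι) {f : ι → G} (hf : Memℓp f 2) : Memℓp (fun i => f (e i)) 2 := by
  have h2 : 0 < (2 : ENNReal).toReal := by norm_num
  rw [memℓp_gen_iff h2] at hf ⊢
  exact (e.summable_iff (f := fun i => ‖f i‖ ^ (2 : ENNReal).toReal)).2 hf

variable [InnerProductSpace ℂ G]

/-- The reindexing of a vector-valued `ℓ²` space by a permutation of the index set. -/
noncomputable def lpReindex (e : ι ≃ ι) : lp (fun _ : ι => G) 2 ≃ₗᵢ[ℂ] lp (fun _ : ι => G) 2 where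
  toFun f := ⟨fun i => f (e i), memℓp_comp_equiv e f.2⟩
  invFun f := ⟨fun i => f (e.symm i), memℓp_comp_equiv e.symm f.2⟩
  map_add' _ _ := rfl
  map_smul' _ _ := rfl
  left_inv f := by ext i; simp
  right_inv f := by ext i; simp
  norm_map' f := by
    have h2 : 0 < (2 : ENNReal).toReal := by norm_num
    rw [lp.norm_eq_tsum_rpow h2, lp.norm_eq_tsum_rpow h2]
    congr 1
    exact e.tsum_eq (fun i => ‖f i‖ ^ (2 : ENNReal).toReal)

end Reindex

section Dilation

variable {H : Type u} [NormedAddCommGroup H] [InnerProductSpace ℂ H]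

theorem exists_defect [CompleteSpace H] {T : H →L[ℂ] H} (hT : ‖T‖ ≤ 1) :
    ∃ D : H →L[ℂ] H, ∀ x y, ⟪D x, D y⟫_ℂ = ⟪x, y⟫_ℂ - ⟪T x, T y⟫_ℂ := by
  have h : 0 ≤ 1 - star T * T := by
    rw [nonneg_iff_isPositive, isPositive_iff_complex]
    intro x
    have h1 : ⟪(1 - star T * T) x, x⟫_ℂ = ((‖x‖ ^ 2 - ‖T x‖ ^ 2 : ℝ) : ℂ) := by
      rw [sub_apply, inner_sub_left, star_eq_adjoint]
      change ⟪x, x⟫_ℂ - ⟪adjoint T (T x), x⟫_ℂ = _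
      rw [adjoint_inner_left, inner_self_eq_norm_sq_to_K, inner_self_eq_norm_sq_to_K]
      push_cast
      rfl
    have h2 : ‖T x‖ ≤ ‖x‖ := by simpa using T.le_of_opNorm_le hT x
    rw [h1]
    exact ⟨rfl, sub_nonneg.2 (by gcongr)⟩
  obtain ⟨D, hD⟩ := CStarAlgebra.nonneg_iff_eq_star_mul_self.1 h
  refine ⟨D, fun x y => ?_⟩
  have h1 : ⟪x, (1 - star T * T) y⟫_ℂ = ⟪x, (star D * D) y⟫_ℂ := by rw [hD]
  simpa [sub_apply, inner_sub_right, star_eq_adjoint, adjoint_inner_right] using h1.symm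

/-- Telescoping; nilpotency kills the last term, so h ↦ (D T^j h)_j is isometric. -/
theorem sum_inner_defect {T D : H →L[ℂ] H} (hD : ∀ x y, ⟪D x, D y⟫_ℂ = ⟪x, y⟫_ℂ - ⟪T x, T y⟫_ℂ)
    {N : ℕ} (hN : T ^ N = 0) (x y : H) :
    ∑ j ∈ range N, ⟪D ((T ^ j) x), D ((T ^ j) y)⟫_ℂ = ⟪x, y⟫_ℂ := by
  have : ∀ j ∈ range N, ⟪D ((T ^ j) x), D ((T ^ j) y)⟫_ℂ =
      ⟪(T ^ j) x, (T ^ j) y⟫_ℂ - ⟪(T ^ (j + 1)) x, (T ^ (j + 1)) y⟫_ℂ := by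
    intro j _
    rw [hD, pow_succ']
    rfl
  rw [sum_congr rfl this, sum_range_sub' (fun j => ⟪(T ^ j) x, (T ^ j) y⟫_ℂ), hN]
  simp

/-- The column `x ↦ (B i j • x)_i` of a real matrix, as an operator on a Hilbert space. -/
noncomputable def columnMap {N : ℕ} (B : Matrix (Fin N) (Fin N) ℝ) (j : Fin N) :
    H →ₗ[ℂ] PiLp 2 (fun _ : Fin N => H) where
  toFun x := WithLp.toLp 2 fun i => (B i j : ℂ) • x
  map_add' x y := by ext i; simp
  map_smul' c x := by ext i; simp [smul_comm c]

theorem inner_columnMap {N : ℕ} (B : Matrix (Fin N) (Fin N) ℝ) (j l : Fin N) (x y : H) :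
    ⟪columnMap B j x, columnMap B l y⟫_ℂ = ((B.transpose * B) j l : ℝ) * ⟪x, y⟫_ℂ := by
  simp only [columnMap, LinearMap.coe_mk, AddHom.coe_mk, PiLp.inner_apply, inner_smul_left,
    inner_smul_right, Complex.conj_ofReal, Matrix.mul_apply, Matrix.transpose_apply]
  push_cast
  rw [sum_mul]
  exact sum_congr rfl fun i _ => by ring

/-- The map `h ↦ ∑ j, δ_j ⊗ (B i j • D T ^ j h)_i` into `ℓ²(ℤ; H ^ N)`. -/
noncomputable def dilationMap {N : ℕ} (B : Matrix (Fin N) (Fin N) ℝ) (D T : H →L[ℂ] H) :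
    H →ₗ[ℂ] lp (fun _ : ℤ => PiLp 2 (fun _ : Fin N => H)) 2 :=
  ∑ j : Fin N, (lp.lsingle 2 ((j : ℕ) : ℤ)) ∘ₗ columnMap B j ∘ₗ (D * T ^ (j : ℕ)).toLinearMap

theorem dilationMap_apply {N : ℕ} (B : Matrix (Fin N) (Fin N) ℝ) (D T : H →L[ℂ] H) (h : H) :
    dilationMap B D T h =
      ∑ j : Fin N, lp.single 2 ((j : ℕ) : ℤ) (columnMap B j (D ((T ^ (j : ℕ)) h))) := by
  rw [dilationMap, LinearMap.sum_apply]
  rfl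

/-- The backward bilateral shift on `ℓ²(ℤ; G)`. -/
noncomputable def bilateralShift (G : Type*) [NormedAddCommGroup G] [InnerProductSpace ℂ G] :
    lp (fun _ : ℤ => G) 2 →L[ℂ] lp (fun _ : ℤ => G) 2 :=
  ((lpReindex (Equiv.addRight (1 : ℤ)) : lp (fun _ : ℤ => G) 2 ≃ₗᵢ[ℂ] lp (fun _ : ℤ => G) 2) :
    lp (fun _ : ℤ => G) 2 →L[ℂ] lp (fun _ : ℤ => G) 2)

theorem linearIsometryEquiv_mem_unitary {E : Type*} [NormedAddCommGroup E] [InnerProductSpace ℂ E]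
    [CompleteSpace E] (e : E ≃ₗᵢ[ℂ] E) : (e : E →L[ℂ] E) ∈ unitary (E →L[ℂ] E) :=
  (Unitary.linearIsometryEquiv.symm e).2

theorem bilateralShift_mem_unitary (G : Type*) [NormedAddCommGroup G] [InnerProductSpace ℂ G]
    [CompleteSpace G] : bilateralShift G ∈
      unitary (lp (fun _ : ℤ => G) 2 →L[ℂ] lp (fun _ : ℤ => G) 2) :=
  linearIsometryEquiv_mem_unitary _

theorem bilateralShift_apply {G : Type*} [NormedAddCommGroup G] [InnerProductSpace ℂ G]
    (f : lp (fun _ : ℤ => G) 2) (i : ℤ) : bilateralShift G f i = f (i + 1) := rfl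

theorem bilateralShift_pow_apply {G : Type*} [NormedAddCommGroup G] [InnerProductSpace ℂ G] (k : ℕ)
    (f : lp (fun _ : ℤ => G) 2) (i : ℤ) : (bilateralShift G ^ k) f i = f (i + k) := by
  induction k generalizing f i with
  | zero => simp
  | succ k ih =>
    rw [pow_succ]
    change (bilateralShift G ^ k) (bilateralShift G f) i = _
    rw [ih, bilateralShift_apply]
    push_cast
    rw [add_assoc]

/-- Shifting by k pairs column j with column j+k, so only the k-th diagonal of BᵀB occurs. Its
constant value c factors out and the defect sum telescopes; terms with j+k ≥ N vanish on both sides.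
The case k = 0 gives the isometry, k ≥ 1 the dilation identity. -/
theorem inner_dilationMap_shift {N : ℕ} {B : Matrix (Fin N) (Fin N) ℝ} {D T : H →L[ℂ] H}
    (hD : ∀ x y, ⟪D x, D y⟫_ℂ = ⟪x, y⟫_ℂ - ⟪T x, T y⟫_ℂ) (hN : T ^ N = 0) (k : ℕ) {c : ℝ}
    (hB : ∀ j l : Fin N, (l : ℕ) = j + k → (B.transpose * B) j l = c) (g h : H) :
    ⟪dilationMap B D T g, (bilateralShift _ ^ k) (dilationMap B D T h)⟫_ℂ =
      c * ⟪g, (T ^ k) h⟫_ℂ := by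
  rw [dilationMap_apply, sum_inner, ← sum_inner_defect hD hN, mul_sum, sum_range]
  refine sum_congr rfl fun j _ => ?_
  rw [lp.inner_single_left, bilateralShift_pow_apply, dilationMap_apply, lp.coeFn_sum, Finset.sum_apply,
    inner_sum]
  have hpow : (T ^ (j : ℕ)) ((T ^ k) h) = (T ^ (j + k : ℕ)) h := by rw [pow_add]; rfl
  rw [hpow]
  by_cases hjk : j + k < N
  · rw [sum_eq_single ⟨j + k, hjk⟩]
    · rw [lp.coeFn_single]
      have : ((j : ℕ) : ℤ) + k = (((⟨j + k, hjk⟩ : Fin N) : ℕ) : ℤ) := by push_cast; rfl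
      rw [this, Pi.single_eq_same, inner_columnMap, hB _ _ rfl]
    · intro l _ hl
      rw [lp.coeFn_single, Pi.single_eq_of_ne, inner_zero_right]
      intro h
      exact hl (Fin.ext (by simp only; omega))
    · simp
  · rw [sum_eq_zero, pow_eq_zero_of_le (not_lt.1 hjk) hN]
    · simp
    · intro l _
      rw [lp.coeFn_single, Pi.single_eq_of_ne, inner_zero_right]
      intro h
      have := l.2
      omega

theorem isRhoContraction_of_posSemidef [CompleteSpace H] {ρ a : ℝ} (hρ : ρ ≠ 0) {N : ℕ}
    (hM : (toeplitzMatrix ρ a N).PosSemidef) {T : H →L[ℂ] H} (hT : ‖T‖ ≤ 1) (hN : T ^ N = 0) :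
    IsRhoContraction ρ ((a : ℂ) • T) := by
  obtain ⟨D, hD⟩ := exists_defect hT
  obtain ⟨B, hB⟩ : ∃ B : Matrix (Fin N) (Fin N) ℝ, toeplitzMatrix ρ a N = B.transpose * B := by
    open scoped MatrixOrder Matrix.Norms.L2Operator in
    exact CStarAlgebra.nonneg_iff_eq_star_mul_self.mp hM.nonneg
  have hB0 : ∀ j l : Fin N, (l : ℕ) = j + 0 → (B.transpose * B) j l = 1 := by
    intro j l h
    rw [← hB]
    simp [toeplitzMatrix, toeplitzEntry, h]
  have hBk : ∀ k, 1 ≤ k → ∀ j l : Fin N, (l : ℕ) = j + k → (B.transpose * B) j l = a ^ k / ρ := by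
    intro k hk j l h
    rw [← hB]
    have h1 : (j : ℕ) ≠ l := by omega
    have h2 : Nat.dist (j : ℕ) l = k := by unfold Nat.dist; omega
    simp [toeplitzMatrix, toeplitzEntry, h1, h2]
  let V : H →ₗᵢ[ℂ] lp (fun _ : ℤ => PiLp 2 (fun _ : Fin N => H)) 2 :=
    (dilationMap B D T).isometryOfInner fun g h => by
      simpa using inner_dilationMap_shift hD hN 0 hB0 g h
  refine ⟨_, _, _, inferInstance, V, bilateralShift _, bilateralShift_mem_unitary _, ?_⟩
  intro k hk
  ext h
  refine ext_inner_left ℂ fun g => ?_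
  have := inner_dilationMap_shift hD hN k (hBk k hk) g h
  rw [smul_pow, smul_apply, smul_apply, inner_smul_right, inner_smul_right, comp_apply,
    adjoint_inner_right, comp_apply]
  refine Eq.trans ?_ (congrArg (fun z => (ρ : ℂ) * z) this.symm)
  have hρ' : (ρ : ℂ) ≠ 0 := by exact_mod_cast hρ
  push_cast
  field_simp

end Dilation

/-! ### The truncated shift and its Gram matrix -/

theorem truncatedShift_apply {N : ℕ} (x : EuclideanSpace ℂ (Fin N)) (i : Fin N) :
    truncatedShift N x i = if h : (i : ℕ) + 1 < N then x ⟨i + 1, h⟩ else 0 := by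
  have h1 : truncatedShift N x i = ∑ j : Fin N, (if (i : ℕ) + 1 = (j : ℕ) then (1 : ℂ) else 0) * x j := by
    rw [truncatedShift, Matrix.ofLp_toEuclideanCLM]
    rfl
  rw [h1]
  split_ifs with h
  · rw [sum_eq_single ⟨i + 1, h⟩]
    · simp
    · intro j _ hj
      rw [if_neg, zero_mul]
      intro h2
      exact hj (Fin.ext h2.symm)
    · simp
  · refine sum_eq_zero fun j _ => ?_
    rw [if_neg (by have := j.2; omega), zero_mul]

theorem truncatedShift_pow_apply {N : ℕ} (k : ℕ) (x : EuclideanSpace ℂ (Fin N)) (i : Fin N) :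
    (truncatedShift N ^ k) x i = if h : (i : ℕ) + k < N then x ⟨i + k, h⟩ else 0 := by
  induction k generalizing i with
  | zero => simp
  | succ k ih =>
    rw [pow_succ']
    change truncatedShift N ((truncatedShift N ^ k) x) i = _
    rw [truncatedShift_apply]
    simp only [ih]
    have h : (i : ℕ) + 1 + k = i + (k + 1) := by omega
    simp only [h]
    split_ifs with h1 h2 h2
    · rfl
    · rfl
    · omega
    · rfl

theorem truncatedShift_pow_self (N : ℕ) : truncatedShift N ^ N = 0 := by
  ext x i
  rw [truncatedShift_pow_apply, dif_neg (by omega)]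
  rfl

theorem norm_truncatedShift_le (N : ℕ) : ‖truncatedShift N‖ ≤ 1 := by
  refine opNorm_le_bound _ zero_le_one fun x => ?_
  rw [one_mul]
  rcases N with _ | n
  · simp [Subsingleton.elim x 0]
  · rw [EuclideanSpace.norm_eq, EuclideanSpace.norm_eq]
    refine Real.sqrt_le_sqrt ?_
    rw [Fin.sum_univ_castSucc, Fin.sum_univ_succ (n := n) (fun i => ‖x i‖ ^ 2)]
    have h1 : truncatedShift (n + 1) x (Fin.last n) = 0 := by
      rw [truncatedShift_apply, dif_neg (by simp)]
    have h2 : ∀ i : Fin n, truncatedShift (n + 1) x i.castSucc = x i.succ := by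
      intro i
      rw [truncatedShift_apply, dif_pos (by simp)]
      rfl
    simp only [h1, h2, norm_zero]
    nlinarith [sq_nonneg ‖x 0‖]

theorem inner_pow_map_pow_map {E : Type*} [NormedAddCommGroup E] [InnerProductSpace ℂ E]
    [CompleteSpace E] {U : E →L[ℂ] E} (hU : U ∈ unitary (E →L[ℂ] E)) (i k : ℕ) (v w : E) :
    ⟪(U ^ i) v, (U ^ (i + k)) w⟫_ℂ = ⟪v, (U ^ k) w⟫_ℂ := by
  rw [pow_add]
  exact (U ^ i).inner_map_map_of_mem_unitary (pow_mem hU i) v ((U ^ k) w)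

theorem posSemidef_of_isRhoContraction {ρ a : ℝ} (hρ : ρ ≠ 0) {N : ℕ}
    (h : IsRhoContraction ρ ((a : ℂ) • truncatedShift N)) : (toeplitzMatrix ρ a N).PosSemidef := by
  obtain ⟨K, _, _, _, V, U, hU, hd⟩ := h
  set e : Fin N → EuclideanSpace ℂ (Fin N) := fun i => EuclideanSpace.single i 1
  have hinner : ∀ (i j : Fin N) (k : ℕ), 1 ≤ k →
      ⟪V (e i), (U ^ k) (V (e j))⟫_ℂ = if (i : ℕ) + k = j then ((a ^ k / ρ : ℝ) : ℂ) else 0 := by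
    intro i j k hk
    have h1 := congrArg (fun A => ⟪e i, A (e j)⟫_ℂ) (hd k hk)
    simp only [smul_pow, smul_apply, inner_smul_right, comp_apply, adjoint_inner_right] at h1
    have h2 : ⟪e i, (truncatedShift N ^ k) (e j)⟫_ℂ = if (i : ℕ) + k = j then 1 else 0 := by
      simp only [e, EuclideanSpace.inner_single_left, map_one, one_mul, truncatedShift_pow_apply]
      by_cases h : (i : ℕ) + k = j
      · rw [dif_pos (by have := j.2; omega), if_pos h]
        simp [h]
      · rw [if_neg h]
        split_ifs with h3
        · rw [PiLp.single_apply, if_neg]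
          intro h4
          exact h (congrArg Fin.val h4)
        · rfl
    rw [h2] at h1
    have hρ' : (ρ : ℂ) ≠ 0 := by exact_mod_cast hρ
    have h3 : ⟪V (e i), (U ^ k) (V (e j))⟫_ℂ = (a : ℂ) ^ k * (if (i : ℕ) + k = j then 1 else 0) / ρ := by
      rw [eq_div_iff hρ', h1, mul_comm]
      rfl
    rw [h3]
    split_ifs <;> simp
  have hlt : ∀ i j : Fin N, (i : ℕ) < j →
      ⟪(U ^ (i : ℕ)) (V (e i)), (U ^ (j : ℕ)) (V (e j))⟫_ℂ = (toeplitzEntry ρ a i j : ℂ) := by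
    intro i j hij
    obtain ⟨k, hk⟩ : ∃ k, (j : ℕ) = i + k := ⟨j - i, by omega⟩
    rw [hk, inner_pow_map_pow_map hU, hinner i j k (by omega), if_pos hk.symm, toeplitzEntry,
      if_neg (by omega)]
    have : Nat.dist (i : ℕ) (i + k) = k := by unfold Nat.dist; omega
    rw [this]
  have hgram : ∀ i j : Fin N,
      ⟪(U ^ (i : ℕ)) (V (e i)), (U ^ (j : ℕ)) (V (e j))⟫_ℂ = (toeplitzEntry ρ a i j : ℂ) := by
    intro i j
    rcases lt_trichotomy (i : ℕ) j with hij | hij | hij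
    · exact hlt i j hij
    · obtain rfl := Fin.ext hij
      have := inner_pow_map_pow_map hU i 0 (V (e i)) (V (e i))
      rw [add_zero] at this
      rw [this]
      simp [e, toeplitzEntry]
    · rw [← inner_conj_symm, hlt j i hij, Complex.conj_ofReal, toeplitzEntry_comm]
  rw [toeplitzMatrix_posSemidef_iff]
  intro x
  have h0 : ⟪∑ i : Fin N, (x i : ℂ) • (U ^ (i : ℕ)) (V (e i)),
      ∑ j : Fin N, (x j : ℂ) • (U ^ (j : ℕ)) (V (e j))⟫_ℂ = (toeplitzForm ρ a N x : ℂ) := by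
    simp only [sum_inner, inner_sum, inner_smul_left, inner_smul_right, hgram, Complex.conj_ofReal,
      toeplitzForm, sum_range]
    push_cast
    refine sum_congr rfl fun i _ => ?_
    rw [mul_sum]
    exact sum_congr rfl fun j _ => by rw [toeplitzEntry_comm]; ring
  have h1 := inner_self_nonneg (𝕜 := ℂ) (x := ∑ i : Fin N, (x i : ℂ) • (U ^ (i : ℕ)) (V (e i)))
  rw [h0] at h1
  simpa using h1

theorem isRhoContraction_smul_truncatedShift_iff {ρ a : ℝ} (hρ : ρ ≠ 0) {N : ℕ} :
    IsRhoContraction ρ ((a : ℂ) • truncatedShift N) ↔ ∀ x, 0 ≤ toeplitzForm ρ a N x := by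
  rw [← toeplitzMatrix_posSemidef_iff]
  exact ⟨posSemidef_of_isRhoContraction hρ, fun h => isRhoContraction_of_posSemidef hρ h
    (norm_truncatedShift_le N) (truncatedShift_pow_self N)⟩

/-! ### The radius as an extremal problem; stability of definiteness -/

theorem rhoRadius_truncatedShift {ρ : ℝ} (hρ : ρ ≠ 0) (N : ℕ) :
    rhoRadius ρ (truncatedShift N) = sInf {γ : ℝ | 0 < γ ∧ ∀ x, 0 ≤ toeplitzForm ρ γ⁻¹ N x} := by
  simp only [rhoRadius, isRhoContraction_smul_truncatedShift_iff hρ]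

theorem bddBelow_setOf_pos_and (p : ℝ → Prop) : BddBelow {γ : ℝ | 0 < γ ∧ p γ} :=
  ⟨0, fun _ h => h.1.le⟩

theorem rhoRadius_truncatedShift_le {ρ b : ℝ} (hρ : ρ ≠ 0) {N : ℕ} (hb : 0 < b)
    (h : ∀ x, 0 ≤ toeplitzForm ρ b N x) : rhoRadius ρ (truncatedShift N) ≤ b⁻¹ := by
  rw [rhoRadius_truncatedShift hρ]
  exact csInf_le (bddBelow_setOf_pos_and _) ⟨inv_pos.2 hb, by rwa [inv_inv]⟩

theorem continuous_toeplitzEntry (ρ : ℝ) (i j : ℕ) : Continuous fun a => toeplitzEntry ρ a i j := by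
  unfold toeplitzEntry
  split_ifs <;> fun_prop

theorem continuous_toeplitzForm (ρ : ℝ) (N : ℕ) (x : ℕ → ℝ) :
    Continuous fun a => toeplitzForm ρ a N x := by
  unfold toeplitzForm
  have := continuous_toeplitzEntry ρ
  fun_prop

theorem toeplitzForm_extendZero (ρ a : ℝ) {N : ℕ} (v : Fin N → ℝ) :
    toeplitzForm ρ a N (extendZero v) =
      ∑ i : Fin N, ∑ j : Fin N, v i * toeplitzEntry ρ a i j * v j := by
  simp only [toeplitzForm, sum_range]
  simp [extendZero]

theorem toeplitzForm_eq_fin (ρ a : ℝ) {N : ℕ} (x : ℕ → ℝ) :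
    toeplitzForm ρ a N x = ∑ i : Fin N, ∑ j : Fin N, x i * toeplitzEntry ρ a i j * x j := by
  simp only [toeplitzForm, sum_range]

/-- Strict positivity on the compact unit sphere persists for nearby parameters; homogeneity extends
it to all vectors. -/
theorem toeplitzForm_eventually_nonneg {ρ a : ℝ} {N : ℕ}
    (h : ∀ x, (∃ i < N, x i ≠ 0) → 0 < toeplitzForm ρ a N x) :
    ∀ᶠ b in 𝓝 a, ∀ x, 0 ≤ toeplitzForm ρ b N x := by
  have hc : Continuous fun p : ℝ × (Fin N → ℝ) =>
      ∑ i : Fin N, ∑ j : Fin N, p.2 i * toeplitzEntry ρ p.1 i j * p.2 j := by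
    have := fun i j => (continuous_toeplitzEntry ρ i j).comp
      (continuous_fst : Continuous (Prod.fst : ℝ × (Fin N → ℝ) → ℝ))
    simp only [Function.comp_def] at this
    fun_prop
  have hev : ∀ᶠ b in 𝓝 a, ∀ v ∈ Metric.sphere (0 : Fin N → ℝ) 1,
      0 < ∑ i : Fin N, ∑ j : Fin N, v i * toeplitzEntry ρ b i j * v j := by
    refine (isCompact_sphere _ _).eventually_forall_of_forall_eventually fun v hv => ?_
    refine hc.continuousAt.eventually (lt_mem_nhds ?_)
    simp only
    rw [← toeplitzForm_extendZero]
    apply h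
    have hv0 : v ≠ 0 := by
      rintro rfl
      simp at hv
    obtain ⟨i, hi⟩ := Function.ne_iff.1 hv0
    exact ⟨i, i.2, by simpa [extendZero] using hi⟩
  filter_upwards [hev] with b hb x
  rw [toeplitzForm_eq_fin]
  set v : Fin N → ℝ := fun i => x i
  by_cases hv : v = 0
  · have : ∀ i : Fin N, x i = 0 := fun i => congrFun hv i
    simp [this]
  · have hn : 0 < ‖v‖ := norm_pos_iff.2 hv
    have := hb (‖v‖⁻¹ • v) (by simp [norm_smul, hn.ne'])
    have h2 : ∑ i : Fin N, ∑ j : Fin N, x i * toeplitzEntry ρ b i j * x j =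
        ‖v‖ ^ 2 * ∑ i : Fin N, ∑ j : Fin N,
          (‖v‖⁻¹ • v) i * toeplitzEntry ρ b i j * (‖v‖⁻¹ • v) j := by
      simp only [mul_sum]
      refine sum_congr rfl fun i _ => sum_congr rfl fun j _ => ?_
      change x i * _ * x j = ‖v‖ ^ 2 * (‖v‖⁻¹ * x i * _ * (‖v‖⁻¹ * x j))
      field_simp
    rw [h2]
    positivity

theorem exists_gt_toeplitzForm_nonneg {ρ a : ℝ} {N : ℕ}
    (h : ∀ x, (∃ i < N, x i ≠ 0) → 0 < toeplitzForm ρ a N x) :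
    ∃ b > a, ∀ x, 0 ≤ toeplitzForm ρ b N x := by
  obtain ⟨b, h1, h2⟩ := (((toeplitzForm_eventually_nonneg h).filter_mono
    nhdsWithin_le_nhds).and (self_mem_nhdsWithin (s := Set.Ioi a))).exists
  exact ⟨b, h2, h1⟩

/-- At a = 1, ρM is (ρ-1) times the identity plus the all-ones matrix. -/
theorem toeplitzForm_one_pos {ρ : ℝ} (hρ : 1 < ρ) {N : ℕ} {x : ℕ → ℝ} (hx : ∃ i < N, x i ≠ 0) :
    0 < toeplitzForm ρ 1 N x := by
  have hρ0 : 0 < ρ := by linarith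
  refine pos_of_mul_pos_right (a := ρ) ?_ hρ0.le
  rw [mul_toeplitzForm hρ0.ne']
  simp only [geomConv, one_pow, one_mul, mul_add, sum_add_distrib, ← sum_mul]
  obtain ⟨i, hi, hxi⟩ := hx
  have h1 : 0 < ∑ i ∈ range N, x i * ((ρ - 1) * x i) := by
    refine sum_pos' (fun i _ => ?_) ⟨i, mem_range.2 hi, ?_⟩
    · nlinarith [mul_nonneg (sub_nonneg.2 hρ.le) (mul_self_nonneg (x i))]
    · nlinarith [mul_pos (sub_pos.2 hρ) (mul_self_pos.2 hxi)]
  nlinarith [mul_self_nonneg (∑ i ∈ range N, x i)]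

theorem le_of_toeplitzForm_nonneg {ρ a : ℝ} (hρ : 0 < ρ) {n : ℕ} (hn : 1 ≤ n)
    (h : ∀ x, 0 ≤ toeplitzForm ρ a (n + 1) x) : a ≤ ρ := by
  have h1 := (toeplitzMatrix_posSemidef_iff.2 h).submatrix
    (fun i : Fin 2 => (⟨i, by omega⟩ : Fin (n + 1)))
  -- The test vector is (1,-1) on the leading 2×2 block.
  have h2 : 0 ≤ toeplitzForm ρ a 2 (fun i => 1 - 2 * i) := toeplitzMatrix_posSemidef_iff.1 h1 _
  have h3 : toeplitzForm ρ a 2 (fun i => 1 - 2 * i) = 2 - 2 * (a / ρ) := by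
    simp [toeplitzForm, sum_range_succ, toeplitzEntry, Nat.dist]
    ring
  rw [h3] at h2
  have : a / ρ ≤ 1 := by linarith
  rwa [div_le_one hρ] at this

/-! ### The extremal scale a(ρ) -/

section Radius

variable {ρ : ℝ} {n : ℕ}

theorem setOf_toeplitzForm_nonneg_nonempty (hρ : 1 < ρ) (n : ℕ) :
    {γ : ℝ | 0 < γ ∧ ∀ x, 0 ≤ toeplitzForm ρ γ⁻¹ (n + 1) x}.Nonempty := by
  obtain ⟨b, hb, h⟩ := exists_gt_toeplitzForm_nonneg (fun x => toeplitzForm_one_pos hρ (N := n + 1))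
  exact ⟨b⁻¹, inv_pos.2 (by linarith), by rwa [inv_inv]⟩

theorem inv_le_rhoRadius_truncatedShift (hρ : 1 < ρ) (hn : 1 ≤ n) :
    ρ⁻¹ ≤ rhoRadius ρ (truncatedShift (n + 1)) := by
  have hρ0 : 0 < ρ := by linarith
  rw [rhoRadius_truncatedShift hρ0.ne']
  refine le_csInf (setOf_toeplitzForm_nonneg_nonempty hρ n) fun γ hγ => ?_
  exact inv_le_of_inv_le₀ hγ.1 (le_of_toeplitzForm_nonneg hρ0 hn hγ.2)

theorem shiftScale_pos (hρ : 1 < ρ) (hn : 1 ≤ n) : 0 < shiftScale n ρ :=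
  inv_pos.2 ((inv_pos.2 (by linarith)).trans_le (inv_le_rhoRadius_truncatedShift hρ hn))

theorem shiftScale_le (hρ : 1 < ρ) (hn : 1 ≤ n) : shiftScale n ρ ≤ ρ := by
  have := inv_anti₀ (inv_pos.2 (by linarith)) (inv_le_rhoRadius_truncatedShift hρ hn)
  rwa [inv_inv] at this

theorem le_shiftScale {b : ℝ} (hρ : 1 < ρ) (hn : 1 ≤ n) (hb : 0 < b)
    (h : ∀ x, 0 ≤ toeplitzForm ρ b (n + 1) x) : b ≤ shiftScale n ρ := by
  have := inv_anti₀ (inv_pos.1 (shiftScale_pos hρ hn))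
    (rhoRadius_truncatedShift_le (by linarith) hb h)
  rwa [inv_inv] at this

theorem one_lt_shiftScale (hρ : 1 < ρ) (hn : 1 ≤ n) : 1 < shiftScale n ρ := by
  obtain ⟨b, hb, h⟩ := exists_gt_toeplitzForm_nonneg (fun x => toeplitzForm_one_pos hρ (N := n + 1))
  exact hb.trans_le (le_shiftScale hρ hn (by linarith) h)

theorem toeplitzForm_shiftScale_nonneg (hρ : 1 < ρ) (hn : 1 ≤ n) (x : ℕ → ℝ) :
    0 ≤ toeplitzForm ρ (shiftScale n ρ) (n + 1) x := by
  have hlt : ∀ b, 0 < b → b < shiftScale n ρ → 0 ≤ toeplitzForm ρ b (n + 1) x := by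
    intro b hb0 hb
    have h1 : rhoRadius ρ (truncatedShift (n + 1)) < b⁻¹ := by
      have := inv_strictAnti₀ hb0 hb
      rwa [shiftScale, inv_inv] at this
    rw [rhoRadius_truncatedShift (by linarith)] at h1
    obtain ⟨γ, hγ, h2⟩ := exists_lt_of_csInf_lt (setOf_toeplitzForm_nonneg_nonempty hρ n) h1
    exact toeplitzForm_nonneg_of_le hn hb0.le (le_inv_of_le_inv₀ hγ.1 h2.le) hγ.2 x
  refine ge_of_tendsto (((continuous_toeplitzForm ρ (n + 1) x).tendsto _).mono_left
    nhdsWithin_le_nhds : Tendsto _ (𝓝[<] (shiftScale n ρ)) _) ?_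
  filter_upwards [self_mem_nhdsWithin, (lt_mem_nhds (shiftScale_pos hρ hn)).filter_mono
    nhdsWithin_le_nhds] with b hb hb0
  exact hlt b hb0 hb

/-- Otherwise M would be definite at a(ρ), hence nonnegative slightly beyond it, against maximality.
-/
theorem exists_geomConv_null (hρ : 1 < ρ) (hn : 1 ≤ n) : ∃ x : ℕ → ℝ, (∃ i < n + 1, x i ≠ 0) ∧
    ∀ i < n + 1, geomConv (shiftScale n ρ) (n + 1) x (i + 1) + (ρ - 1) * x i = 0 := by
  have hρ0 : ρ ≠ 0 := by linarith
  by_contra! hcon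
  have hpos : ∀ x, (∃ i < n + 1, x i ≠ 0) → 0 < toeplitzForm ρ (shiftScale n ρ) (n + 1) x := by
    intro x hx
    refine (toeplitzForm_shiftScale_nonneg hρ hn x).lt_of_ne' fun h0 => ?_
    obtain ⟨i, hi, hne⟩ := hcon x hx
    apply hne
    have hM := toeplitzMatrix_posSemidef_iff.2 (toeplitzForm_shiftScale_nonneg hρ hn)
    rw [← dotProduct_toeplitzMatrix_mulVec] at h0
    have h1 := congrFun ((hM.dotProduct_mulVec_zero_iff _).1 h0) ⟨i, hi⟩
    rw [← sum_toeplitzEntry_mul hρ0 _ _ hi, sum_range]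
    exact mul_eq_zero_of_right _ h1
  obtain ⟨b, hb, h⟩ := exists_gt_toeplitzForm_nonneg hpos
  exact (le_shiftScale hρ hn ((shiftScale_pos hρ hn).trans hb) h).not_gt hb

end Radius

/-! ### The critical value and the bound for nilpotents -/

theorem shiftScale_critical {n : ℕ} (hn : 1 ≤ n) : shiftScale n (n + 2) = (n + 2) / n := by
  have hn0 : (0 : ℝ) < n := by exact_mod_cast hn
  have hρ : (1 : ℝ) < n + 2 := by linarith
  have ha : (0 : ℝ) < (n + 2) / n := by positivity
  refine le_antisymm ?_ (le_shiftScale hρ hn ha (toeplitzForm_critical_nonneg hn))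
  by_contra! hlt
  set a := shiftScale n ((n : ℝ) + 2)
  have ha' : 0 < a := ha.trans hlt
  set r : ℝ := (n + 2) / n / a with hr
  have hr1 : r < 1 := (div_lt_one ha').2 hlt
  have hr0 : 0 < r := by positivity
  have hr2 : r ^ 2 < 1 := by nlinarith
  have h := le_toeplitzForm_mul hn (toeplitzForm_shiftScale_nonneg hρ hn) hr2.le
    (fun i => (n : ℝ) - 2 * i)
  rw [hr, mul_div_cancel₀ _ ha'.ne', toeplitzForm_critical_null hn, ← hr] at h
  have : 0 < (1 - r ^ 2) * ((n : ℝ) - 2 * n) ^ 2 := by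
    have h1 : (n : ℝ) - 2 * n = -n := by ring
    rw [h1, neg_sq]
    exact mul_pos (by linarith) (by positivity)
  linarith

theorem shiftDiscriminant_eq_zero_iff {n : ℕ} (hn : 1 ≤ n) {ρ : ℝ} (hρ : 1 < ρ) :
    shiftDiscriminant n ρ = 0 ↔ ρ = n + 2 := by
  constructor
  · intro h
    rw [shiftDiscriminant_eq] at h
    obtain ⟨x, hx, hnull⟩ := exists_geomConv_null hρ hn
    have h1 := one_lt_shiftScale hρ hn
    have h2 := shiftScale_le hρ hn
    set a := shiftScale n ρ
    have f1 : a ^ 2 - 1 ≠ 0 := by nlinarith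
    -- For ρ ≤ 2, a ≤ ρ gives ρ - a(2-ρ) ≥ ρ(ρ-1) > 0.
    have f2 : (a + 1) * ρ - 2 * a ≠ 0 := by
      rcases le_total 2 ρ with h3 | h3 <;> nlinarith
    have f3 : (a - 1) * ρ = 2 * a :=
      sub_eq_zero.1 ((mul_eq_zero.1 h).resolve_left (mul_ne_zero f1 f2))
    have h2ρ : 2 < ρ := by
      by_contra! h3
      nlinarith
    exact eq_add_two_of_null h2ρ f3 hnull hx
  · rintro rfl
    have hn0 : (n : ℝ) ≠ 0 := by exact_mod_cast (by omega : n ≠ 0)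
    rw [shiftDiscriminant_eq, shiftScale_critical hn]
    refine mul_eq_zero_of_right _ ?_
    field_simp
    ring

theorem rhoRadius_le_of_pow_eq_zero {H : Type u} [NormedAddCommGroup H] [InnerProductSpace ℂ H]
    [CompleteSpace H] {T : H →L[ℂ] H} {n : ℕ} (hn : 1 ≤ n) (hT : T ^ (n + 1) = 0) :
    rhoRadius ((n : ℝ) + 2) T ≤ n / (n + 2) * ‖T‖ := by
  have hn0 : (0 : ℝ) < n := by exact_mod_cast hn
  have hc0 : (0 : ℝ) < n / (n + 2) := by positivity
  -- Working with c > ‖T‖ and letting c decrease covers T = 0, where dividing by ‖T‖ fails.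
  have key : ∀ c, ‖T‖ < c → rhoRadius ((n : ℝ) + 2) T ≤ n / (n + 2) * c := by
    intro c hc
    have hcpos : 0 < c := (norm_nonneg T).trans_lt hc
    refine csInf_le (bddBelow_setOf_pos_and _) ⟨by positivity, ?_⟩
    have h1 : ‖((c⁻¹ : ℝ) : ℂ) • T‖ ≤ 1 := by
      rw [norm_smul, Complex.norm_real, Real.norm_of_nonneg (by positivity), inv_mul_le_one₀ hcpos]
      exact hc.le
    have h2 : (((c⁻¹ : ℝ) : ℂ) • T) ^ (n + 1) = 0 := by rw [smul_pow, hT, smul_zero]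
    have h3 := isRhoContraction_of_posSemidef (by positivity : (n : ℝ) + 2 ≠ 0)
      (toeplitzMatrix_posSemidef_iff.2 (toeplitzForm_critical_nonneg hn)) h1 h2
    rw [smul_smul, ← Complex.ofReal_mul] at h3
    have h4 : ((n : ℝ) / (n + 2) * c)⁻¹ = (n + 2) / n * c⁻¹ := by rw [mul_inv, inv_div]
    rwa [h4]
  rw [← div_le_iff₀' hc0]
  refine le_of_forall_gt_imp_ge_of_dense fun c hc => ?_
  rw [div_le_iff₀' hc0]
  exact key c hc

theorem proposition3p1 :
    (∀ n : ℕ, 1 ≤ n →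
      (∀ ρ : ℝ, 1 < ρ → (shiftDiscriminant n ρ = 0 ↔ ρ = (n : ℝ) + 2)) ∧
      rhoRadius ((n : ℝ) + 2) (truncatedShift (n + 1)) = (n : ℝ) / ((n : ℝ) + 2)) ∧
    (∀ (H : Type u) [NormedAddCommGroup H] [InnerProductSpace ℂ H] [CompleteSpace H]
      (T : H →L[ℂ] H) (m : ℕ), 2 ≤ m → T ^ m = 0 →
        rhoRadius ((m : ℝ) + 1) T ≤ (((m : ℝ) - 1) / ((m : ℝ) + 1)) * ‖T‖) := by
  refine ⟨fun n hn => ⟨fun ρ hρ => shiftDiscriminant_eq_zero_iff hn hρ, ?_⟩, ?_⟩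
  · rw [← inv_inv (rhoRadius _ _)]
    exact (congrArg _ (shiftScale_critical hn)).trans (inv_div _ _)
  · intro H _ _ _ T m hm hT
    obtain ⟨n, rfl⟩ : ∃ n, m = n + 1 := ⟨m - 1, by omega⟩
    have := rhoRadius_le_of_pow_eq_zero (by omega) hT
    have h1 : ((n + 1 : ℕ) : ℝ) + 1 = n + 2 := by push_cast; ring
    have h2 : ((n + 1 : ℕ) : ℝ) - 1 = n := by push_cast; ring
    rwa [h1, h2]
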